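/- Formulas are built from variables $p_0,p_1,\dots$ with $\wedge,\vee,\supset,\neg$. The Frege system $\mathcal{H}$Łuk for three-valued Łukasiewicz logic has modus ponens as its only rule and the axiom schemas $A\supset(B\supset A)$; $(A\supset B)\supset((B\supset C)\supset(A\supset C))$; $((A\supset B)\supset B)\supset((B\supset A)\supset A)$; $((((A\supset B)\supset A)\supset A)\supset(B\supset C))\supset(B\supset C)$; $(A\wedge B)\supset A$; $(A\wedge B)\supset B$; $(A\supset B)\supset((A\supset C)\supset(A\supset(B\wedge C)))$; $A\supset(A\vee B)$; $B\supset(A\vee B)$; $(A\supset C)\supset((B\supset C)\supset((A\vee B)\supset C))$; $(\neg B\supset\neg A)\supset(A\supset B)$. An $\mathcal{H}$Łuk proof of $A$ in $N$ steps is a sequence of $N$ formulas ending in $A$, each an axiom or obtained from earlier ones by modus ponens. A proof of $A$ in $n\ge 1$ steps in the nested disjunction elimination system Ł$_{3_{n\vee}}$ is a sequence of sequents $\Gamma_1\Rightarrow A_1,\dots,\Gamma_n\Rightarrow A_n$ whose left-hand sides are finite sequences of formulas, with $\Gamma_n=\langle\rangle$ and $A_n=A$, and with $\Gamma_0=\langle\rangle$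 by convention, such that each step $i$ is justified in one of the following ways: (a) $\Gamma_i=\Gamma_{i-1}$ and $A_i$ is an axiom of $\mathcal{H}$Łuk; (b) $\Gamma_i=\Gamma_k*\langle A_i\rangle$ for some $k<i$ available to $i$ (possibly $k=0$); this opens the assumption $A_i$; (c) $\vee$-elimination: for some $A,B$ and $l,k,j<i$ we have $A_l=A\vee B$, $A_k=A_j=A_i$, $\Gamma_k=\Gamma_i*\langle A\rangle$, $\Gamma_j=\Gamma_i*\langle B\rangle$, step $l\ge1$ is available to $i$, and $k,j$ have not become unavailable; afterwards all steps from the last opening of $A$ with context $\Gamma_k$ up to step $k$, and from the last opening of $B$ with context $\Gamma_j$ up to step $j$, are unavailable; (d) $\Gamma_i=\Gamma_{i-1}$ and $A_i$ follows by modus ponens from two earlier sequents available to $i$. Here step $k$ is available to step $i>k$ if $\Gamma_k$ is an initial subsequence of $\Gamma_i$ and step $k$ has not become unavailable by an earlier application of (c). Let $A(0,m)=2m$, $A(n+1,0)=1$, $A(n+1,m+1)=A(n,A(n+1,m))$, and let $\alpha(n)=\min\{i : A(i,i)\ge n\}$ be the inverse Ackermann function. Let $\log^{(*0)}=\log_2$,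 and let $\log^{(*(i+1))}x$ be the least number of iterations of $\log^{(*i)}$ that take $x$ to a value at most $1$. Theorem. (1) There is a constant $C$ such that every formula with an Ł$_{3_{n\vee}}$ proof in $n$ steps has an $\mathcal{H}$Łuk proof in at most $C\cdot n\cdot\alpha(n)$ steps. (2) There is a constant $C$ such that for every $i\ge 0$, every formula with an Ł$_{3_{n\vee}}$ proof in $n$ steps in which assumptions are opened $m$ times has an $\mathcal{H}$Łuk proof in at most $C\cdot n\cdot\max(1,\,m\log^{(*i)}m)$ steps; thus in $O(n\cdot m\log^{(*i)}m)$ steps when $m\ge2$. -/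

import Mathlib

/-- Formulas over the propositional variables `p₀, p₁, …` and the connectives `∧, ∨, ⊃, ¬`. -/
inductive Formula : Type
  | var : ℕ → Formula
  | and : Formula → Formula → Formula
  | or : Formula → Formula → Formula
  | imp : Formula → Formula → Formula
  | neg : Formula → Formula

namespace Formula

/-- Instances of the axiom schemas of the Frege system `HŁuk` for three-valued Łukasiewicz
logic. -/
inductive IsAxiomInstance : Formula → Prop
  | a1 (A B : Formula) : IsAxiomInstance (A.imp (B.imp A))
  | a2 (A B C : Formula) :
      IsAxiomInstance ((A.imp B).imp ((B.imp C).imp (A.imp C)))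
  | a3 (A B : Formula) :
      IsAxiomInstance (((A.imp B).imp B).imp ((B.imp A).imp A))
  | a4 (A B C : Formula) :
      IsAxiomInstance (((((A.imp B).imp A).imp A).imp (B.imp C)).imp (B.imp C))
  | a5 (A B : Formula) : IsAxiomInstance ((A.and B).imp A)
  | a6 (A B : Formula) : IsAxiomInstance ((A.and B).imp B)
  | a7 (A B C : Formula) :
      IsAxiomInstance ((A.imp B).imp ((A.imp C).imp (A.imp (B.and C))))
  | a8 (A B : Formula) : IsAxiomInstance (A.imp (A.or B))
  | a9 (A B : Formula) : IsAxiomInstance (B.imp (A.or B))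
  | a10 (A B C : Formula) :
      IsAxiomInstance ((A.imp C).imp ((B.imp C).imp ((A.or B).imp C)))
  | a11 (A B : Formula) : IsAxiomInstance ((B.neg.imp A.neg).imp (A.imp B))

end Formula

/-- `L` is an `HŁuk` derivation from the set `Γ`: each entry is an axiom, a member of `Γ`, or
follows from two earlier entries by modus ponens. -/
def IsHLukDerivation (Γ : Set Formula) (L : List Formula) : Prop :=
  ∀ (i : ℕ) (hi : i < L.length),
    L[i].IsAxiomInstance ∨ L[i] ∈ Γ ∨
      ∃ (j k : ℕ) (hj : j < i) (hk : k < i),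
        L[k]'(hk.trans hi) = (L[j]'(hj.trans hi)).imp L[i]

/-- `L` is an `HŁuk` proof of `A`; its number of steps is `L.length`. -/
def IsHLukProof (L : List Formula) (A : Formula) : Prop :=
  IsHLukDerivation ∅ L ∧ L.getLast? = some A

/-- The justification of a step of a nested proof, with the numbers of the steps it refers to. -/
inductive NestedRule : Type
  /-- an axiom of `HŁuk` -/
  | ax : NestedRule
  /-- opening an assumption on top of the context of step `k` -/
  | hyp (k : ℕ) : NestedRule
  /-- nested disjunction elimination: the disjunction is step `l`, the two case conclusions are
  the steps `k` and `j` -/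
  | orElim (l k j : ℕ) : NestedRule
  /-- modus ponens from the implication, step `j`, and its antecedent, step `k` -/
  | mp (j k : ℕ) : NestedRule

/-- Does this justification open an assumption? -/
def NestedRule.opens : NestedRule → Bool
  | .hyp _ => true
  | _ => false

/-- A sequence of `steps` justified sequents `ctx i ⇒ fml i`, `1 ≤ i ≤ steps`. Step `0` is not a
sequent: only its context, which has to be empty, is used. -/
structure NestedSequence where
  steps : ℕ
  ctx : ℕ → List Formula
  fml : ℕ → Formula
  rule : ℕ → NestedRule

namespace NestedSequence

variable (P : NestedSequence)

/-- Step `p` lies between the (last) opening `o` of the innermost assumption of step `k` and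
step `k`, both included. -/
def InBox (p k : ℕ) : Prop :=
  ∃ o, 1 ≤ o ∧ o ≤ p ∧ p ≤ k ∧ (P.rule o).opens = true ∧ P.ctx o = P.ctx k ∧
    ∀ o', o < o' → o' ≤ k → (P.rule o').opens = true → P.ctx o' ≠ P.ctx k

/-- Step `p` has become unavailable before step `i`: an application of disjunction elimination
before `i` has closed one of its two boxes around `p`. -/
def Discharged (p i : ℕ) : Prop :=
  ∃ t l k j, 1 ≤ t ∧ t < i ∧ P.rule t = .orElim l k j ∧ (P.InBox p k ∨ P.InBox p j)

/-- Step `k` is available to step `i`: it is an earlier one, its context is an initial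
subsequence of the context of step `i`, and it has not become unavailable. -/
def Available (k i : ℕ) : Prop :=
  k < i ∧ P.ctx k <+: P.ctx i ∧ ¬ P.Discharged k i

/-- Step `i` is correctly justified. When an assumption is opened, `k` may be taken to be the last
available step with the context in question; only this context matters, so nothing is required
about it. -/
def StepOK (i : ℕ) : Prop :=
  match P.rule i with
  | .ax => P.ctx i = P.ctx (i - 1) ∧ (P.fml i).IsAxiomInstance
  | .hyp k => P.Available k i ∧ P.ctx i = P.ctx k ++ [P.fml i]
  | .orElim l k j =>
      1 ≤ l ∧ P.Available l i ∧
      k < i ∧ ¬ P.Discharged k i ∧ j < i ∧ ¬ P.Discharged j i ∧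
      ∃ A B : Formula, P.fml l = A.or B ∧
        P.ctx k = P.ctx i ++ [A] ∧ P.fml k = P.fml i ∧
        P.ctx j = P.ctx i ++ [B] ∧ P.fml j = P.fml i
  | .mp j k =>
      P.ctx i = P.ctx (i - 1) ∧
      1 ≤ j ∧ P.Available j i ∧ 1 ≤ k ∧ P.Available k i ∧
      P.fml j = (P.fml k).imp (P.fml i)

/-- `P` is a proof of `A` in the nested system `Ł₃ₙ∨`. -/
def IsProofOf (A : Formula) : Prop :=
  P.ctx 0 = [] ∧ 1 ≤ P.steps ∧ (∀ i, 1 ≤ i → i ≤ P.steps → P.StepOK i) ∧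
    P.ctx P.steps = [] ∧ P.fml P.steps = A

/-- The number of times assumptions are opened in `P`. -/
def numOpenings : ℕ :=
  ((Finset.Icc 1 P.steps).filter fun i => (P.rule i).opens = true).card

end NestedSequence

/-- The Ackermann function with `A(0, m) = 2m`, `A(n + 1, 0) = 1` and
`A(n + 1, m + 1) = A(n, A(n + 1, m))`; so `A(1, m) = 2 ^ m`. -/
def ackermann : ℕ → ℕ → ℕ
  | 0, m => 2 * m
  | _ + 1, 0 => 1
  | n + 1, m + 1 => ackermann n (ackermann (n + 1) m)

/-- The inverse Ackermann function `α(n) = min {i | A(i, i) ≥ n}`. -/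
noncomputable def inverseAckermann (n : ℕ) : ℕ :=
  sInf {i | n ≤ ackermann i i}

/-- The functions `log^{(*i)}`: `log^{(*0)}` is the binary logarithm, and `log^{(*(i+1))} x` is
the least number of iterations of `log^{(*i)}` that take `x` to a value at most `1`. -/
noncomputable def logStar : ℕ → ℝ → ℝ
  | 0, x => Real.logb 2 x
  | i + 1, x => ((sInf {k : ℕ | (logStar i)^[k] x ≤ 1} : ℕ) : ℝ)

-- In three-valued Łukasiewicz logic `A ⇾ B` does not satisfy the deduction theorem, but `A ⇾ A ⇾ B`
-- does, because a third copy of an assumption can be contracted away (`Yields.contraction`). A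
-- sequent `Γ ⇒ A` is therefore translated to `γ ⇾ γ ⇾ A`, with `γ` the conjunction of `Γ`. Each
-- rule then costs a bounded number of steps (`Yields.mp_under`, `Yields.or_elim_under`), apart from
-- the transfer of an earlier sequent to a longer context, which needs the implication from the
-- longer conjunction to the shorter one.
--
-- The contexts form a tree under the prefix order, with at most `m + 1` nodes. The implications
-- from child to parent are axioms. What remains is to derive few further implications so that every
-- node reaches each of its ancestors by a short chain. This is the classical shortcut problem for
-- trees: `IsForestOrder.exists_shortcuts` bridges depth `ackermann k t` by paths of length `2 * k +
-- 1` at a cost of order `k * t` per node.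
--
-- With `k` about `α(n)` and `t = 4`, both the shortcuts and the translated steps cost `O(n α(n))`,
-- which is (1). For (2) it is enough to take `k = 0` and derive all ancestor implications: this
-- costs `O(m²)`, hence `O(n * max 1 m)` in total, and `log^{(*i)} m ≥ 1` when `m ≥ 2`, whatever `i`
-- is.

infixr:60 "⇾" => Formula.imp

/-! ### Counting derivation steps. -/

/-- `T` arises from `S` by adding, one at a time, `n` formulas that are axioms or follow by modus
ponens from formulas already present. -/
inductive HLukExtends (S : Set Formula) : ℕ → Set Formula → Prop
  | refl : HLukExtends S 0 S
  | ax {n : ℕ} {T : Set Formula} {A : Formula} :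
      HLukExtends S n T → A.IsAxiomInstance → HLukExtends S (n + 1) (insert A T)
  | mp {n : ℕ} {T : Set Formula} {A B : Formula} :
      HLukExtends S n T → (A ⇾ B) ∈ T → A ∈ T → HLukExtends S (n + 1) (insert B T)

namespace HLukExtends

variable {S T U : Set Formula} {m n : ℕ}

theorem subset (h : HLukExtends S n T) : S ⊆ T := by
  induction h with
  | refl => exact subset_rfl
  | ax _ _ ih => exact ih.trans (Set.subset_insert _ _)
  | mp _ _ _ ih => exact ih.trans (Set.subset_insert _ _)

theorem trans (h : HLukExtends S m T) (h' : HLukExtends T n U) : HLukExtends S (m + n) U := by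
  induction h' with
  | refl => exact h
  | ax _ hA ih => exact ih.ax hA
  | mp _ hAB hA ih => exact ih.mp hAB hA

theorem mono_left {S' : Set Formula} (h : HLukExtends S n T) (hS : S ⊆ S') :
    ∃ T', T ⊆ T' ∧ HLukExtends S' n T' := by
  induction h with
  | refl => exact ⟨S', hS, .refl⟩
  | ax _ hA ih =>
    obtain ⟨T', hT, h'⟩ := ih
    exact ⟨_, Set.insert_subset_insert hT, h'.ax hA⟩
  | mp _ hAB hA ih =>
    obtain ⟨T', hT, h'⟩ := ih
    exact ⟨_, Set.insert_subset_insert hT, h'.mp (hT hAB) (hT hA)⟩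

theorem append_singleton {Γ : Set Formula} {L : List Formula} {A : Formula}
    (hL : IsHLukDerivation Γ L)
    (hA : A.IsAxiomInstance ∨ A ∈ Γ ∨ ∃ B ∈ L, (B ⇾ A) ∈ L) :
    IsHLukDerivation Γ (L ++ [A]) := by
  intro i hi
  rcases lt_or_ge i L.length with h | h
  · have e : ∀ (q : ℕ) (hq : q < L.length) (hq' : q < (L ++ [A]).length),
        (L ++ [A])[q] = L[q] := fun q hq _ => List.getElem_append_left hq
    rcases hL i h with h1 | h1 | ⟨j, k, hj, hk, h1⟩
    · exact .inl (by rwa [e i h])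
    · exact .inr (.inl (by rwa [e i h]))
    · refine .inr (.inr ⟨j, k, hj, hk, ?_⟩)
      rw [e i h, e j (hj.trans h), e k (hk.trans h)]
      exact h1
  · have hi' : i = L.length := by simp at hi; omega
    subst hi'
    rcases hA with h1 | h1 | ⟨B, hB, hBA⟩
    · exact .inl (by simpa using h1)
    · exact .inr (.inl (by simpa using h1))
    · obtain ⟨j, hj, rfl⟩ := List.getElem_of_mem hB
      obtain ⟨k, hk, hk'⟩ := List.getElem_of_mem hBA
      refine .inr (.inr ⟨j, k, hj, hk, ?_⟩)
      simp [List.getElem_append_left, hj, hk, hk']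

theorem exists_derivation (h : HLukExtends ∅ n T) :
    ∃ L : List Formula, L.length = n ∧ IsHLukDerivation ∅ L ∧ ∀ A ∈ T, A ∈ L := by
  induction h with
  | refl => exact ⟨[], rfl, fun i hi => by simp at hi, fun A hA => by simp at hA⟩
  | ax _ hA ih =>
    obtain ⟨L, hlen, hL, hT⟩ := ih
    refine ⟨L ++ [_], by simp [hlen], append_singleton hL (.inl hA), ?_⟩
    rintro B (rfl | hB)
    · simp
    · exact List.mem_append_left _ (hT B hB)
  | mp _ hAB hA ih =>
    obtain ⟨L, hlen, hL, hT⟩ := ih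
    refine ⟨L ++ [_], by simp [hlen],
      append_singleton hL (.inr (.inr ⟨_, hT _ hA, hT _ hAB⟩)), ?_⟩
    rintro B (rfl | hB)
    · simp
    · exact List.mem_append_left _ (hT B hB)

end HLukExtends

theorem IsHLukDerivation.take {Γ : Set Formula} {L : List Formula} (hL : IsHLukDerivation Γ L)
    (n : ℕ) : IsHLukDerivation Γ (L.take n) := by
  intro i hi
  have hi' : i < L.length := lt_of_lt_of_le hi (by simp)
  rcases hL i hi' with h1 | h1 | ⟨j, k, hj, hk, h1⟩
  · exact .inl (by simpa using h1)
  · exact .inr (.inl (by simpa using h1))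
  · exact .inr (.inr ⟨j, k, hj, hk, by simpa using h1⟩)

/-- All formulas in `Δ` can be derived from `S` in at most `n` steps altogether. -/
def Yields (S : Set Formula) (n : ℕ) (Δ : Set Formula) : Prop :=
  ∃ m ≤ n, ∃ T, HLukExtends S m T ∧ Δ ⊆ T

namespace Yields

variable {S S' Δ Θ : Set Formula} {a b n : ℕ} {A B C : Formula}

theorem mono (h : Yields S a Δ) (hab : a ≤ b) : Yields S b Δ := by
  obtain ⟨m, hm, T, hT, hΔ⟩ := h
  exact ⟨m, hm.trans hab, T, hT, hΔ⟩

theorem mono_left (h : Yields S a Δ) (hS : S ⊆ S') : Yields S' a Δ := by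
  obtain ⟨m, hm, T, hT, hΔ⟩ := h
  obtain ⟨T', hTT', h'⟩ := hT.mono_left hS
  exact ⟨m, hm, T', h', hΔ.trans hTT'⟩

theorem mono_right (h : Yields S a Δ) (hΘ : Θ ⊆ Δ) : Yields S a Θ := by
  obtain ⟨m, hm, T, hT, hΔ⟩ := h
  exact ⟨m, hm, T, hT, hΘ.trans hΔ⟩

theorem of_subset (h : Δ ⊆ S) : Yields S 0 Δ :=
  ⟨0, le_rfl, S, .refl, h⟩

theorem trans (h : Yields S a Δ) (h' : Yields (S ∪ Δ) b Θ) : Yields S (a + b) (Δ ∪ Θ) := by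
  obtain ⟨m, hm, T, hT, hΔ⟩ := h
  obtain ⟨k, hk, U, hU, hΘ⟩ := h'
  obtain ⟨U', hUU', h'⟩ := hU.mono_left (Set.union_subset hT.subset hΔ)
  exact ⟨m + k, add_le_add hm hk, U', hT.trans h',
    Set.union_subset (hΔ.trans h'.subset) (hΘ.trans hUU')⟩

theorem union (h : Yields S a Δ) (h' : Yields S b Θ) : Yields S (a + b) (Δ ∪ Θ) :=
  h.trans (h'.mono_left Set.subset_union_left)

theorem cut (h : Yields S a {A}) (h' : Yields (insert A S) b Δ) : Yields S (a + b) Δ :=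
  (h.trans (h'.mono_left (by rw [Set.union_comm]; rfl))).mono_right Set.subset_union_right

theorem mem (h : A ∈ S) : Yields S 0 {A} :=
  of_subset (by simpa using h)

theorem ax (h : A.IsAxiomInstance) : Yields S 1 {A} :=
  ⟨1, le_rfl, _, HLukExtends.refl.ax h, by simp⟩

theorem mp (h : Yields S a {A ⇾ B}) (h' : Yields S b {A}) : Yields S (a + b + 1) {B} := by
  obtain ⟨m, hm, T, hT, hAB⟩ := h.union h'
  exact ⟨m + 1, by omega, _, hT.mp (A := A) (B := B) (hAB (by simp)) (hAB (by simp)), by simp⟩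

/-- Formulas each of which needs at most `c` steps from those of smaller rank. -/
theorem family {ι : Type*} (I : Finset ι) (ρ : ι → ℕ) (F : ι → Formula) (c : ℕ)
    (h : ∀ i ∈ I, Yields (S ∪ {A | ∃ j ∈ I, ρ j < ρ i ∧ F j = A}) c {F i}) :
    Yields S (I.card * c) {A | ∃ i ∈ I, F i = A} := by
  classical
  -- The formulas are derived in order of increasing rank, so the one of largest rank comes last.
  induction I using Finset.induction_on_max_value ρ with
  | empty => exact (of_subset (by simp)).mono (Nat.zero_le _)
  | insert a s ha hmax ih =>
    have h1 := ih fun i hi => (h i (Finset.mem_insert_of_mem hi)).mono_left (by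
      refine Set.union_subset_union_right _ ?_
      rintro A ⟨j, hj, hlt, rfl⟩
      rcases Finset.mem_insert.1 hj with rfl | hj
      · exact absurd (hmax i hi) (by omega)
      · exact ⟨j, hj, hlt, rfl⟩)
    have h2 := (h a (Finset.mem_insert_self _ _)).mono_left
      (S' := S ∪ {A | ∃ i ∈ s, F i = A}) (by
      refine Set.union_subset_union_right _ ?_
      rintro A ⟨j, hj, hlt, rfl⟩
      rcases Finset.mem_insert.1 hj with rfl | hj
      · omega
      · exact ⟨j, hj, rfl⟩)
    rw [Finset.card_insert_of_notMem ha, add_mul, one_mul]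
    refine (h1.trans h2).mono_right ?_
    rintro A ⟨i, hi, rfl⟩
    rcases Finset.mem_insert.1 hi with rfl | hi
    · exact .inr rfl
    · exact .inl ⟨i, hi, rfl⟩

theorem exists_proof (h : Yields ∅ n {A}) :
    ∃ L : List Formula, IsHLukProof L A ∧ L.length ≤ n := by
  obtain ⟨m, hm, T, hT, hA⟩ := h
  obtain ⟨L, hlen, hL, hTL⟩ := hT.exists_derivation
  obtain ⟨i, hi, rfl⟩ := List.getElem_of_mem (hTL _ (hA rfl))
  refine ⟨L.take (i + 1), ⟨hL.take _, ?_⟩, by simp; omega⟩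
  rw [List.take_succ_eq_append_getElem hi, List.getLast?_concat]

/-! ### Derived rules of three-valued Łukasiewicz logic. -/

theorem imp_trans (h : Yields S a {A ⇾ B}) (h' : Yields S b {B ⇾ C}) :
    Yields S (a + b + 3) {A ⇾ C} :=
  (((ax (.a2 A B C)).mp h).mp h').mono (by omega)

theorem imp_const (h : Yields S a {A}) (B : Formula) : Yields S (a + 2) {B ⇾ A} :=
  ((ax (.a1 A B)).mp h).mono (by omega)

theorem assertion (A B : Formula) : Yields S 5 {A ⇾ (A ⇾ B) ⇾ B} :=
  (ax (.a1 A (B ⇾ A))).imp_trans (ax (.a3 B A))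

theorem exchange (A B C : Formula) : Yields S 11 {(A ⇾ B ⇾ C) ⇾ B ⇾ A ⇾ C} :=
  (ax (.a2 A (B ⇾ C) C)).imp_trans
    ((ax (.a2 B ((B ⇾ C) ⇾ C) (A ⇾ C))).mp (assertion B C))

theorem swap (h : Yields S a {A ⇾ B ⇾ C}) : Yields S (a + 12) {B ⇾ A ⇾ C} :=
  ((exchange A B C).mp h).mono (by omega)

theorem imp_self (A : Formula) : Yields S 15 {A ⇾ A} :=
  ((ax (.a1 A (A ⇾ A ⇾ A))).swap.mp (ax (.a1 A A))).mono (by omega)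

theorem prefixing (A B C : Formula) : Yields S 13 {(B ⇾ C) ⇾ (A ⇾ B) ⇾ A ⇾ C} :=
  (ax (.a2 A B C)).swap

theorem imp_map (A : Formula) (h : Yields S a {B ⇾ C}) :
    Yields S (a + 14) {(A ⇾ B) ⇾ A ⇾ C} :=
  ((prefixing A B C).mp h).mono (by omega)

/-- In Łukasiewicz logic `(P ⇾ Q) ⇾ Q` is the join of `P` and `Q`. It is monotone in `P`, so `P ⇾ Z`
takes it to the join of `Z` and `Q`; by the symmetry `a3` this is `(Q ⇾ Z) ⇾ Z`, from which `Q ⇾ Z`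
can be detached. -/
theorem join_le {P Q Z : Formula} (h : Yields S a {Q ⇾ Z}) :
    Yields S (a + 32) {(P ⇾ Z) ⇾ ((P ⇾ Q) ⇾ Q) ⇾ Z} :=
  (((ax (.a2 P Z Q)).imp_trans (ax (.a2 (Z ⇾ Q) (P ⇾ Q) Q))).imp_trans
    (((ax (.a3 Z Q)).imp_trans ((assertion (Q ⇾ Z) Z).mp h)).imp_map ((P ⇾ Q) ⇾ Q))).mono
      (by omega)

/-- The only use of the three-valued axiom `a4`. The instance used is itself a join, of `(A ⇾ A ⇾ B)
∨ A` and `A ∨ B`, all joins being in the sense of `join_le`. Each of `A`, `B` and `A ⇾ A ⇾ B`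
implies the conclusion, `A` by the hypothesis. -/
theorem contraction (h : Yields S a {A ⇾ A ⇾ A ⇾ B}) : Yields S (a + 83) {A ⇾ A ⇾ B} := by
  refine h.cut ?_
  have h0 : Yields (insert (A ⇾ A ⇾ A ⇾ B) S) 0 {A ⇾ A ⇾ A ⇾ B} := mem (by simp)
  have hP := (ax (S := insert (A ⇾ A ⇾ A ⇾ B) S) (.a3 (A ⇾ A ⇾ B) A)).imp_trans
    ((assertion (A ⇾ A ⇾ A ⇾ B) (A ⇾ A ⇾ B)).mp h0)
  have hB : Yields (insert (A ⇾ A ⇾ A ⇾ B) S) 5 {B ⇾ A ⇾ A ⇾ B} :=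
    (ax (.a1 B A)).imp_trans (ax (.a1 (A ⇾ B) A))
  have hQ := (hB.join_le (P := A)).mp h0
  exact ((hQ.join_le.mp hP).mp (ax (.a4 A (A ⇾ B) B))).mono (by omega)

/-- Modus ponens under the implication `A ⇾ A ⇾ _`. -/
theorem mp_under (h : Yields S a {A ⇾ A ⇾ B ⇾ C}) (h' : Yields S b {A ⇾ A ⇾ B}) :
    Yields S (a + b + 300) {A ⇾ A ⇾ C} := by
  have h1 : Yields S (a + 27) {B ⇾ A ⇾ A ⇾ C} := ((h.imp_trans (exchange A B C)).swap).mono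
    (by omega)
  -- The two premises together use four copies of `A`; two contractions leave two.
  have h2 := (h'.imp_trans (h1.imp_map A))
  exact h2.contraction.contraction.mono (by omega)

theorem under (h : Yields S a {B}) (A : Formula) : Yields S (a + 4) {A ⇾ A ⇾ B} :=
  (h.imp_const A).imp_const A

theorem weaken (h : Yields S a {B ⇾ A}) (h' : Yields S b {A ⇾ A ⇾ C}) :
    Yields S (2 * a + b + 18) {B ⇾ B ⇾ C} :=
  (h.imp_trans (h.imp_trans h').swap).mono (by omega)

theorem and_intro (A B : Formula) : Yields S 50 {A ⇾ B ⇾ A.and B} :=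
  ((ax (.a1 A B)).imp_trans ((ax (.a7 B A B)).swap.mp (imp_self B))).mono (by omega)

theorem uncurry (h : Yields S a {A.and B ⇾ A.and B ⇾ C}) :
    Yields S (a + 200) {B ⇾ B ⇾ A ⇾ A ⇾ C} := by
  have h1 : Yields S (a + 79) {B ⇾ A ⇾ A.and B ⇾ C} :=
    ((and_intro A B).swap.imp_trans (h.imp_map A)).mono (by omega)
  have h2 : Yields S 78 {(A.and B ⇾ C) ⇾ B ⇾ A ⇾ C} :=
    ((and_intro A B).swap.imp_trans (ax (.a2 A (A.and B) C))).swap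
  exact ((h1.imp_trans (h2.imp_map A)).imp_trans (exchange A B (A ⇾ C))).mono (by omega)

/-- If two copies of `A` and two copies of `B` each give `W`, then `A` and two copies of a
disjunction `X` of `A` and `B` give `W`. -/
theorem disjunction_aux {X W : Formula}
    (hX : ∀ {c d : ℕ} {Z : Formula}, Yields S c {A ⇾ Z} → Yields S d {B ⇾ Z} →
      Yields S (c + d + 20) {X ⇾ Z})
    (hA : Yields S a {A ⇾ A ⇾ W}) (hB : Yields S b {B ⇾ B ⇾ W}) :
    Yields S (2 * a + b + 130) {A ⇾ X ⇾ X ⇾ W} := by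
  have h1 : Yields S (a + 4) {A ⇾ B ⇾ A ⇾ W} := hA.imp_trans (ax (.a1 _ _))
  have h2 : Yields S (b + 18) {B ⇾ B ⇾ A ⇾ W} := hB.imp_trans ((ax (.a1 W A)).imp_map B)
  have h3 := (hX h1 h2).swap.imp_trans (exchange X A W)
  have h4 : Yields S (a + 18) {A ⇾ A ⇾ X ⇾ W} := hA.imp_trans ((ax (.a1 W X)).imp_map A)
  exact (hX h4 h3).swap.mono (by omega)

/-- Pigeonhole: among three choices between `A` and `B`, two agree. The third copy of the
disjunction is later removed by `contraction` in the surrounding context. -/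
theorem disjunction {W : Formula} (hA : Yields S a {A ⇾ A ⇾ W}) (hB : Yields S b {B ⇾ B ⇾ W}) :
    Yields S (3 * a + 3 * b + 263) {A.or B ⇾ A.or B ⇾ A.or B ⇾ W} := by
  have h {c d : ℕ} {Z : Formula} (h1 : Yields S c {A ⇾ Z}) (h2 : Yields S d {B ⇾ Z}) :
      Yields S (c + d + 20) {A.or B ⇾ Z} :=
    (((ax (.a10 A B Z)).mp h1).mp h2).mono (by omega)
  have h1 := disjunction_aux h hA hB
  have h2 := disjunction_aux (fun h1 h2 => (h h2 h1).mono (by omega)) hB hA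
  exact (((ax (.a10 A B _)).mp h1).mp h2).mono (by omega)

/-- Disjunction elimination under the implication `C ⇾ C ⇾ _`. -/
theorem or_elim_under {D : Formula} {c : ℕ} (h : Yields S c {C ⇾ C ⇾ A.or B})
    (hA : Yields S a {C.and A ⇾ C.and A ⇾ D}) (hB : Yields S b {C.and B ⇾ C.and B ⇾ D}) :
    Yields S (3 * a + 3 * b + 3 * c + 3000) {C ⇾ C ⇾ D} := by
  -- Here `W` is `C ⇾ C ⇾ D`: `uncurry` has moved the copies of `C` behind those of the case
  -- assumption. After the three copies of `A.or B` are detached, four copies of `C` remain.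
  have h1 := (disjunction hA.uncurry hB.uncurry).under C
  have h2 := ((h1.mp_under h).mp_under h).mp_under h
  exact h2.contraction.contraction.mono (by omega)

end Yields

/-! ### Growth of the Ackermann function. -/

theorem ackermann_lt (n : ℕ) {m : ℕ} (hm : 1 ≤ m) : m < ackermann n m := by
  induction n generalizing m with
  | zero => simp only [ackermann]; omega
  | succ n ih =>
    induction m, hm using Nat.le_induction with
    | base => simpa [ackermann] using ih (m := 1) le_rfl
    | succ m hm ih' =>
      rw [ackermann]
      have := ih (m := ackermann (n + 1) m) (by omega)
      omega

theorem ackermann_succ_pos (n m : ℕ) : 1 ≤ ackermann (n + 1) m := by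
  cases m with
  | zero => simp [ackermann]
  | succ m => have := ackermann_lt (n + 1) (m := m + 1) (by omega); omega

theorem ackermann_strictMono (n : ℕ) : StrictMono (ackermann n) := by
  cases n with
  | zero => intro a b h; simp only [ackermann]; omega
  | succ n =>
    refine strictMono_nat_of_lt_succ fun m => ?_
    rw [ackermann]
    exact ackermann_lt n (ackermann_succ_pos n m)

theorem ackermann_one (n : ℕ) : ackermann n 1 = 2 := by
  induction n with
  | zero => simp [ackermann]
  | succ n ih => simpa [ackermann] using ih

theorem ackermann_two (n : ℕ) : ackermann n 2 = 4 := by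
  induction n with
  | zero => simp [ackermann]
  | succ n ih => rw [ackermann, ackermann_one, ih]

theorem lt_ackermann_three (n : ℕ) : n < ackermann n 3 := by
  induction n with
  | zero => simp [ackermann]
  | succ n ih =>
    rw [ackermann, ackermann_two]
    exact lt_of_le_of_lt ih (ackermann_strictMono n (by norm_num))

/-- Going up one row makes the constant column `4` dominate the diagonal, so `t` can stay bounded in
the shortcut construction while `k` is about `α(n)`. -/
theorem ackermann_diag_lt (n : ℕ) : ackermann n n < ackermann (n + 1) 4 := by
  have h := lt_ackermann_three (n + 1)
  calc ackermann n n < ackermann n (ackermann (n + 1) 3) := ackermann_strictMono n (by omega)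
    _ = ackermann (n + 1) 4 := (ackermann.eq_3 n 3).symm

/-! ### Forests and shortcuts to ancestors. -/

/-- The ancestor relation of a forest. -/
structure IsForestOrder {X : Type*} (r : X → X → Prop) : Prop where
  refl : ∀ u, r u u
  antisymm : ∀ {u v}, r u v → r v u → u = v
  trans : ∀ {u v w}, r u v → r v w → r u w
  chain : ∀ {u v w}, r u w → r v w → r u v ∨ r v u

section Forest

variable {X : Type*} {V : Finset X} {r : X → X → Prop} {φ : X → Formula} {S : Set Formula}

open Classical in
/-- The number of ancestors of `v` in `V`, with `v` itself. -/
noncomputable def depthIn (V : Finset X) (r : X → X → Prop) (v : X) : ℕ :=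
  (V.filter fun u => r u v).card

theorem depthIn_le_card (V : Finset X) (r : X → X → Prop) (v : X) : depthIn V r v ≤ V.card := by
  classical
  exact Finset.card_filter_le _ _

/-- `u` is the parent of `v` in `V`. -/
def IsParentIn (V : Finset X) (r : X → X → Prop) (u v : X) : Prop :=
  u ∈ V ∧ v ∈ V ∧ r u v ∧ u ≠ v ∧ ∀ w ∈ V, r u w → r w v → w = u ∨ w = v

/-- The implication from the formula of a node `v` to that of its ancestor `u`. -/
def edge (φ : X → Formula) (u v : X) : Formula := φ v ⇾ φ u

theorem Yields.edge_trans {a b : ℕ} {u w v : X} (h : Yields S a {edge φ u w})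
    (h' : Yields S b {edge φ w v}) : Yields S (a + b + 3) {edge φ u v} :=
  (Yields.imp_trans h' h).mono (by omega)

/-- There is a path of at most `n` edges in `Δ` from `v` up to `u`. -/
inductive Linked (φ : X → Formula) (Δ : Set Formula) : ℕ → X → X → Prop
  | refl (n : ℕ) (u : X) : Linked φ Δ n u u
  | step {n : ℕ} {u w v : X} : edge φ u w ∈ Δ → Linked φ Δ n w v → Linked φ Δ (n + 1) u v

namespace Linked

variable {Δ Δ' : Set Formula} {m n : ℕ} {u v w : X}

theorem mono (h : Linked φ Δ m u v) (hΔ : Δ ⊆ Δ') (hmn : m ≤ n) : Linked φ Δ' n u v := by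
  induction h generalizing n with
  | refl => exact .refl _ _
  | step he _ ih =>
    obtain ⟨n, rfl⟩ : ∃ n', n = n' + 1 := ⟨n - 1, by omega⟩
    exact .step (hΔ he) (ih (by omega))

theorem append (h : Linked φ Δ m u w) (h' : Linked φ Δ n w v) : Linked φ Δ (m + n) u v := by
  induction h with
  | refl => exact h'.mono subset_rfl (by omega)
  | step he _ ih => exact (Linked.step he (ih h')).mono subset_rfl (by omega)

theorem single (h : edge φ u v ∈ Δ) : Linked φ Δ 1 u v := .step h (.refl 0 v)

theorem yields (h : Linked φ Δ n u v) : Yields Δ (3 * n + 15) {edge φ u v} := by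
  induction h with
  | refl => exact (Yields.imp_self _).mono (by omega)
  | step he _ ih => exact ((Yields.mem he).edge_trans ih).mono (by omega)

end Linked

namespace IsForestOrder

theorem depthIn_mono (hr : IsForestOrder r) {u v : X} (h : r u v) : depthIn V r u ≤ depthIn V r v := by
  classical
  refine Finset.card_le_card fun w hw => ?_
  simp only [Finset.mem_filter] at hw ⊢
  exact ⟨hw.1, hr.trans hw.2 h⟩

theorem depthIn_lt (hr : IsForestOrder r) {u v : X} (hv : v ∈ V) (h : r u v) (hne : u ≠ v) :
    depthIn V r u < depthIn V r v := by
  classical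
  refine Finset.card_lt_card ⟨fun w hw => ?_, fun hsub => hne ?_⟩
  · simp only [Finset.mem_filter] at hw ⊢
    exact ⟨hw.1, hr.trans hw.2 h⟩
  · have := hsub (Finset.mem_filter.2 ⟨hv, hr.refl v⟩)
    exact hr.antisymm h (Finset.mem_filter.1 this).2

theorem depthIn_pos (hr : IsForestOrder r) {v : X} (hv : v ∈ V) : 1 ≤ depthIn V r v := by
  classical
  exact Finset.card_pos.2 ⟨v, Finset.mem_filter.2 ⟨hv, hr.refl v⟩⟩

theorem ancestor_of_depthIn_le (hr : IsForestOrder r) {u w v : X} (hu : u ∈ V) (h : r u v) (h' : r w v)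
    (hd : depthIn V r u ≤ depthIn V r w) : r u w := by
  rcases hr.chain h h' with h1 | h1
  · exact h1
  · by_cases hne : w = u
    · exact hne ▸ hr.refl w
    · exact absurd (hr.depthIn_lt hu h1 hne) (by omega)

theorem eq_of_depthIn_eq (hr : IsForestOrder r) {u w v : X} (hu : u ∈ V) (hw : w ∈ V) (h : r u v) (h' : r w v)
    (hd : depthIn V r u = depthIn V r w) : u = w :=
  hr.antisymm (hr.ancestor_of_depthIn_le hu h h' hd.le) (hr.ancestor_of_depthIn_le hw h' h hd.ge)

/-- Depth is injective on the ancestors of `v`, with values in the interval from `1` to the depth of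
`v`, and there are exactly as many ancestors as values. Roots have depth `1`. -/
theorem exists_ancestor (hr : IsForestOrder r) {v : X} {e : ℕ} (he : 1 ≤ e) (hev : e ≤ depthIn V r v) :
    ∃ u ∈ V, r u v ∧ depthIn V r u = e := by
  classical
  have hinj : Set.InjOn (depthIn V r) (V.filter fun u => r u v) := by
    intro u hu w hw
    simp only [Finset.coe_filter, Set.mem_ofPred_eq] at hu hw
    exact hr.eq_of_depthIn_eq hu.1 hw.1 hu.2 hw.2
  have himg : (V.filter fun u => r u v).image (depthIn V r) = Finset.Icc 1 (depthIn V r v) := by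
    refine Finset.eq_of_subset_of_card_le ?_ ?_
    · intro d hd
      obtain ⟨u, hu, rfl⟩ := Finset.mem_image.1 hd
      rw [Finset.mem_filter] at hu
      exact Finset.mem_Icc.2 ⟨hr.depthIn_pos hu.1, hr.depthIn_mono hu.2⟩
    · rw [Finset.card_image_of_injOn hinj, Nat.card_Icc]
      simp [depthIn]
  have : e ∈ (V.filter fun u => r u v).image (depthIn V r) := by
    rw [himg]; exact Finset.mem_Icc.2 ⟨he, hev⟩
  obtain ⟨u, hu, rfl⟩ := Finset.mem_image.1 this
  rw [Finset.mem_filter] at hu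
  exact ⟨u, hu.1, hu.2, rfl⟩

theorem isParentIn (hr : IsForestOrder r) {u v : X} (hu : u ∈ V) (hv : v ∈ V) (h : r u v)
    (hd : depthIn V r v = depthIn V r u + 1) : IsParentIn V r u v := by
  refine ⟨hu, hv, h, fun e => by subst e; omega, fun w hw h1 h2 => ?_⟩
  by_contra! hne
  have := hr.depthIn_lt hw h1 hne.1.symm
  have := hr.depthIn_lt hv h2 hne.2
  omega

/-- Edges from the nodes of `R` to their ancestors at most `s` levels higher. -/
theorem yields_upEdges (hr : IsForestOrder r) (hS : ∀ u v, IsParentIn V r u v → edge φ u v ∈ S) {R : Finset X}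
    (hR : R ⊆ V) (s : ℕ) :
    Yields S (R.card * s * 3) {A | ∃ u ∈ V, ∃ v ∈ R, r u v ∧ depthIn V r u < depthIn V r v ∧
      depthIn V r v ≤ depthIn V r u + s ∧ edge φ u v = A} := by
  classical
  set I := (V ×ˢ R).filter fun p => r p.1 p.2 ∧ depthIn V r p.1 < depthIn V r p.2 ∧
    depthIn V r p.2 ≤ depthIn V r p.1 + s with hI
  have hcard : I.card ≤ R.card * s := by
    have := Finset.card_le_card_of_injOn (s := I) (t := R ×ˢ Finset.Icc 1 s)
      (fun p => (p.2, depthIn V r p.2 - depthIn V r p.1)) (fun p hp => ?_) ?_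
    · simpa using this
    · simp only [hI, Finset.coe_filter, Finset.mem_product, Set.mem_ofPred_eq] at hp
      simp only [Finset.coe_product, Set.mem_prod, Finset.mem_coe, Finset.mem_Icc]
      exact ⟨hp.1.2, by omega, by omega⟩
    · rintro ⟨u, v⟩ hp ⟨u', v'⟩ hp' he
      simp only [hI, Finset.coe_filter, Finset.mem_product, Set.mem_ofPred_eq] at hp hp'
      simp only [Prod.mk.injEq] at he
      obtain ⟨rfl, he⟩ := he
      rw [hr.eq_of_depthIn_eq hp.1.1 hp'.1.1 hp.2.1 hp'.2.1 (by omega)]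
  have hfam := Yields.family (S := S) I (fun p => depthIn V r p.2 - depthIn V r p.1)
    (fun p => edge φ p.1 p.2) 3 ?_
  · refine (hfam.mono (Nat.mul_le_mul_right 3 hcard)).mono_right ?_
    rintro A ⟨u, hu, v, hv, h1, h2, h3, rfl⟩
    exact ⟨(u, v), by simp [hI, hu, hv, h1, h2, h3], rfl⟩
  · rintro ⟨u, v⟩ hp
    simp only [hI, Finset.mem_filter, Finset.mem_product] at hp
    obtain ⟨⟨hu, hv⟩, h1, h2, h3⟩ := hp
    by_cases hd : depthIn V r v = depthIn V r u + 1
    · exact (Yields.mem (.inl (hS _ _ (hr.isParentIn hu (hR hv) h1 hd)))).mono (by omega)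
    -- The edge is split at the child `w` of `u` towards `v`, so that the shorter edge still starts
    -- in `R`.
    · obtain ⟨w, hw, hwv, hdw⟩ := hr.exists_ancestor (V := V) (v := v)
        (e := depthIn V r u + 1) (by omega) (by omega)
      have huw : r u w := hr.ancestor_of_depthIn_le hu h1 hwv (by omega)
      refine (Yields.mem (.inl (hS _ _ (hr.isParentIn hu hw huw hdw)))).edge_trans
        (Yields.mem (.inr ⟨(w, v), ?_, ?_, rfl⟩))
      · simp only [hI, Finset.mem_filter, Finset.mem_product]
        exact ⟨⟨hw, hv⟩, hwv, by omega, by omega⟩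
      · simp only; omega

/-- Edges from all nodes to their nearest ancestors on the levels `≡ -c` modulo `s`. -/
theorem yields_rootEdges (hr : IsForestOrder r) (hS : ∀ u v, IsParentIn V r u v → edge φ u v ∈ S) (s c : ℕ) :
    Yields S (V.card * 3) {A | ∃ u ∈ V, ∃ v ∈ V, r u v ∧ depthIn V r u < depthIn V r v ∧
      depthIn V r v < depthIn V r u + s ∧ s ∣ depthIn V r u + c ∧ edge φ u v = A} := by
  classical
  set I := (V ×ˢ V).filter fun p => r p.1 p.2 ∧ depthIn V r p.1 < depthIn V r p.2 ∧
    depthIn V r p.2 < depthIn V r p.1 + s ∧ s ∣ depthIn V r p.1 + c with hI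
  -- Each `v` has at most one such `u`: two multiples of `s` less than `s` below the same number,
  -- and not above it, coincide.
  have hcard : I.card ≤ V.card := by
    refine Finset.card_le_card_of_injOn (fun p => p.2) (fun p hp => ?_) ?_
    · simp only [hI, Finset.coe_filter, Finset.mem_product, Set.mem_ofPred_eq] at hp
      exact hp.1.2
    · rintro ⟨u, v⟩ hp ⟨u', v'⟩ hp' he
      simp only [hI, Finset.coe_filter, Finset.mem_product, Set.mem_ofPred_eq] at hp hp' he
      subst he
      obtain ⟨⟨hu, -⟩, h1, h2, h3, k, hk⟩ := hp
      obtain ⟨⟨hu', -⟩, h1', h2', h3', k', hk'⟩ := hp'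
      have hkk : k = k' := by
        rcases lt_trichotomy k k' with h | h | h
        · have := Nat.mul_le_mul_left s h
          rw [Nat.mul_succ] at this
          omega
        · exact h
        · have := Nat.mul_le_mul_left s h
          rw [Nat.mul_succ] at this
          omega
      subst hkk
      rw [hr.eq_of_depthIn_eq hu hu' h1 h1' (by omega)]
  have hfam := Yields.family (S := S) I (fun p => depthIn V r p.2 - depthIn V r p.1)
    (fun p => edge φ p.1 p.2) 3 ?_
  · refine (hfam.mono (Nat.mul_le_mul_right 3 hcard)).mono_right ?_
    rintro A ⟨u, hu, v, hv, h1, h2, h3, h4, rfl⟩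
    exact ⟨(u, v), by simp [hI, hu, hv, h1, h2, h3, h4], rfl⟩
  · rintro ⟨u, v⟩ hp
    simp only [hI, Finset.mem_filter, Finset.mem_product] at hp
    obtain ⟨⟨hu, hv⟩, h1, h2, h3, h4⟩ := hp
    by_cases hd : depthIn V r v = depthIn V r u + 1
    · exact (Yields.mem (.inl (hS _ _ (hr.isParentIn hu hv h1 hd)))).mono (by omega)
    -- Here the split is at the parent `w` of `v`, so that the shorter edge still ends at `u`, on a
    -- selected level.
    · obtain ⟨w, hw, hwv, hdw⟩ := hr.exists_ancestor (V := V) (v := v)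
        (e := depthIn V r v - 1) (by omega) (by omega)
      have huw : r u w := hr.ancestor_of_depthIn_le hu h1 hwv (by omega)
      have hpar := hr.isParentIn hw hv hwv (by omega)
      refine Yields.edge_trans (w := w) (Yields.mem (.inr ⟨(u, w), ?_, ?_, rfl⟩))
        (Yields.mem (.inl (hS _ _ hpar)))
      · simp only [hI, Finset.mem_filter, Finset.mem_product]
        exact ⟨⟨hu, hw⟩, huw, by omega, by omega, h4⟩
      · change depthIn V r w - depthIn V r u < depthIn V r v - depthIn V r u
        omega

/-- Cutting the edges between different values of `b`. -/
theorem restrict (hr : IsForestOrder r) (b : X → ℕ) : IsForestOrder fun u v => r u v ∧ b u = b v where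
  refl u := ⟨hr.refl u, rfl⟩
  antisymm h h' := hr.antisymm h.1 h'.1
  trans h h' := ⟨hr.trans h.1 h'.1, h.2.trans h'.2⟩
  chain h h' := (hr.chain h.1 h'.1).imp (fun e => ⟨e, h.2.trans h'.2.symm⟩)
    fun e => ⟨e, h'.2.trans h.2.symm⟩

end IsForestOrder

/-- Some residue class of levels is small. -/
theorem exists_sparse_levels (V : Finset X) (d : X → ℕ) {s : ℕ} (hs : 1 ≤ s) :
    ∃ c, (V.filter fun v => s ∣ d v + c).card * s ≤ V.card := by
  obtain ⟨j, hj, hle⟩ := Finset.exists_card_fiber_le_of_card_le_nsmul (s := V)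
    (t := Finset.range s) (f := fun v => d v % s) (b := (V.card : ℚ) / s)
    (by simpa using Nat.one_le_iff_ne_zero.1 hs) (by
      have : (s : ℚ) ≠ 0 := by positivity
      rw [Finset.card_range, nsmul_eq_mul]; field_simp; exact le_rfl)
  have hj := Finset.mem_range.1 hj
  refine ⟨s - j, ?_⟩
  have heq : (V.filter fun v => s ∣ d v + (s - j)) = V.filter fun v => d v % s = j := by
    refine Finset.filter_congr fun v _ => ?_
    constructor
    · rintro ⟨k, hk⟩
      have h1 : (d v + s) % s = (j + s * k) % s := by congr 1; omega
      rwa [Nat.add_mod_right, Nat.add_mul_mod_self_left, Nat.mod_eq_of_lt hj] at h1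
    · intro h
      refine ⟨d v / s + 1, ?_⟩
      have := Nat.div_add_mod (d v) s
      rw [Nat.mul_succ]
      omega
  rw [heq]
  have hs' : (0 : ℚ) < s := by exact_mod_cast hs
  rw [le_div_iff₀ hs'] at hle
  exact_mod_cast hle

namespace IsForestOrder

theorem depthIn_restrict_le (hr : IsForestOrder r) {s : ℕ} (hs : 1 ≤ s) (c : ℕ) (v : X) :
    depthIn V (fun u v => r u v ∧ (depthIn V r u + c) / s = (depthIn V r v + c) / s) v ≤ s := by
  classical
  have := Finset.card_le_card_of_injOn
    (s := V.filter fun u => r u v ∧ (depthIn V r u + c) / s = (depthIn V r v + c) / s)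
    (t := Finset.range s) (fun u => (depthIn V r u + c) % s) (fun u _ => ?_) ?_
  · rw [Finset.card_range] at this
    convert this using 1
    unfold depthIn
    congr
  · simpa using Nat.mod_lt _ hs
  · intro u hu w hw he
    simp only [Finset.coe_filter, Set.mem_ofPred_eq] at hu hw he
    refine hr.eq_of_depthIn_eq hu.1 hw.1 hu.2.1 hw.2.1 ?_
    have h1 := Nat.div_add_mod (depthIn V r u + c) s
    have h2 := Nat.div_add_mod (depthIn V r w + c) s
    rw [hu.2.2, he] at h1
    rw [hw.2.2] at h2
    omega

/-- In a forest of depth at most `ackermann k t`, a number of edges proportional to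
`(k + 1) * t` times the number of nodes links all nodes to their ancestors by short paths. -/
theorem exists_shortcuts (k t : ℕ) (hr : IsForestOrder r)
    (hS : ∀ u v, IsParentIn V r u v → edge φ u v ∈ S)
    (hd : ∀ v ∈ V, depthIn V r v ≤ ackermann k t) :
    ∃ Δ, Yields S (6 * (k + 1) * t * V.card) Δ ∧
      ∀ u ∈ V, ∀ v ∈ V, r u v → Linked φ Δ (2 * k + 1) u v := by
  classical
  induction k generalizing t V r S with
  | zero =>
    refine ⟨_, (hr.yields_upEdges hS subset_rfl (2 * t)).mono (le_of_eq (by ring)), ?_⟩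
    intro u hu v hv h
    by_cases hne : u = v
    · exact hne ▸ .refl _ _
    · have := hd v hv
      rw [ackermann] at this
      exact .single ⟨u, hu, v, hv, h, hr.depthIn_lt hv h hne, by omega, rfl⟩
  | succ k ihk =>
    induction t generalizing r with
    | zero =>
      refine ⟨∅, (Yields.of_subset (Set.empty_subset _)).mono (Nat.zero_le _), ?_⟩
      intro u hu v hv h
      by_cases hne : u = v
      · exact hne ▸ .refl _ _
      · have h1 := hd v hv
        have h2 := hr.depthIn_pos hu
        have h3 := hr.depthIn_lt hv h hne
        rw [ackermann] at h1
        omega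
    | succ t iht =>
      -- The levels are cut into blocks of height `s`, each headed by a level of the sparse set `R`.
      -- `Δ₁` leads from `R` up through one block, `Δ₂` from any node to the head of its block, `Δ₃`
      -- connects `R` recursively (its depth is at most `ackermann k s`, and `R.card * s ≤ V.card`
      -- pays for it), and `Δ₄` treats the inside of the blocks with `t` in place of `t + 1`.
      set s := ackermann (k + 1) t
      have hs : 1 ≤ s := ackermann_succ_pos k t
      obtain ⟨c, hc⟩ := exists_sparse_levels V (depthIn V r) hs
      set R := V.filter fun v => s ∣ depthIn V r v + c
      have hR : R ⊆ V := Finset.filter_subset _ _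
      have h1 := hr.yields_upEdges hS hR s
      have h2 := hr.yields_rootEdges hS s c
      set Δ₁ := {A | ∃ u ∈ V, ∃ v ∈ R, r u v ∧ depthIn V r u < depthIn V r v ∧
        depthIn V r v ≤ depthIn V r u + s ∧ edge φ u v = A}
      set Δ₂ := {A | ∃ u ∈ V, ∃ v ∈ V, r u v ∧ depthIn V r u < depthIn V r v ∧
        depthIn V r v < depthIn V r u + s ∧ s ∣ depthIn V r u + c ∧ edge φ u v = A}
      obtain ⟨Δ₃, h3, hlink₃⟩ := ihk (V := R) (r := r) (S := S ∪ Δ₁) s hr (by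
        rintro u v ⟨hu, hv, huv, hne, hbetween⟩
        refine .inr ⟨u, hR hu, v, hv, huv, hr.depthIn_lt (hR hv) huv hne, ?_, rfl⟩
        by_contra! hlt
        obtain ⟨w, hw, hwv, hdw⟩ := hr.exists_ancestor (V := V) (v := v)
          (e := depthIn V r v - s) (by omega) (by omega)
        have huw : r u w := hr.ancestor_of_depthIn_le (hR hu) huv hwv (by omega)
        have hwR : w ∈ R := by
          refine Finset.mem_filter.2 ⟨hw, ?_⟩
          have : s ∣ depthIn V r v + c := (Finset.mem_filter.1 hv).2
          have h' : depthIn V r v + c = depthIn V r w + c + s := by omega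
          rw [h'] at this
          exact (Nat.dvd_add_left dvd_rfl).1 this
        rcases hbetween w hwR huw hwv with rfl | rfl
        · omega
        · omega) (by
        intro v hv
        refine le_trans (Finset.card_le_card fun u hu => ?_) ((hd v (hR hv)).trans_eq (by rw [ackermann]))
        simp only [Finset.mem_filter] at hu ⊢
        exact ⟨hR hu.1, hu.2⟩)
      obtain ⟨Δ₄, h4, hlink₄⟩ := iht (hr.restrict fun v => (depthIn V r v + c) / s) (by
        rintro u v ⟨hu, hv, ⟨huv, hb⟩, hne, hbetween⟩
        refine hS u v ⟨hu, hv, huv, hne, fun w hw h h' => ?_⟩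
        have e1 : (depthIn V r u + c) / s ≤ (depthIn V r w + c) / s :=
          Nat.div_le_div_right (Nat.add_le_add_right (hr.depthIn_mono h) c)
        have e2 : (depthIn V r w + c) / s ≤ (depthIn V r v + c) / s :=
          Nat.div_le_div_right (Nat.add_le_add_right (hr.depthIn_mono h') c)
        exact hbetween w hw ⟨h, by omega⟩ ⟨h', by omega⟩)
        (fun v _ => hr.depthIn_restrict_le hs c v)
      refine ⟨(Δ₁ ∪ Δ₃) ∪ (Δ₂ ∪ Δ₄), ((h1.trans h3).union (h2.union h4)).mono ?_, ?_⟩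
      · have e : 6 * (k + 1) * s * R.card ≤ 6 * (k + 1) * V.card := by
          calc _ = 6 * (k + 1) * (R.card * s) := by ring
            _ ≤ _ := Nat.mul_le_mul_left _ hc
        calc _ ≤ V.card * 3 + 6 * (k + 1) * V.card
              + (V.card * 3 + 6 * (k + 1 + 1) * t * V.card) := by gcongr
          _ = _ := by ring
      · intro u hu v hv huv
        by_cases hb : (depthIn V r u + c) / s = (depthIn V r v + c) / s
        · exact (hlink₄ u hu v hv ⟨huv, hb⟩).mono
            (Set.subset_union_right.trans Set.subset_union_right) le_rfl
        have hlt : (depthIn V r u + c) / s < (depthIn V r v + c) / s := lt_of_le_of_ne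
          (Nat.div_le_div_right (Nat.add_le_add_right (hr.depthIn_mono huv) c)) hb
        have hu1 := Nat.div_add_mod (depthIn V r u + c) s
        have hu2 := Nat.mod_lt (depthIn V r u + c) hs
        have hv1 := Nat.div_add_mod (depthIn V r v + c) s
        have hv2 := Nat.mod_lt (depthIn V r v + c) hs
        have hmul := Nat.mul_le_mul_left s hlt
        rw [Nat.mul_succ] at hmul
        set x := s * ((depthIn V r u + c) / s)
        set y := s * ((depthIn V r v + c) / s)
        -- On the way from `v` up to `u`, `p` heads the block of `v` and `q` heads the block just
        -- below that of `u`. The path runs through `p` and `q`, adding one edge at either end of a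
        -- path inside `R`.
        obtain ⟨p, hp, hpv, hdp⟩ := hr.exists_ancestor (V := V) (v := v) (e := y - c)
          (by omega) (by omega)
        obtain ⟨q, hq, hqv, hdq⟩ := hr.exists_ancestor (V := V) (v := v) (e := x + s - c)
          (by omega) (by omega)
        have hpc : depthIn V r p + c = y := by omega
        have hqc : depthIn V r q + c = x + s := by omega
        have hpR : p ∈ R := Finset.mem_filter.2 ⟨hp, hpc ▸ Dvd.intro _ rfl⟩
        have hqR : q ∈ R := Finset.mem_filter.2 ⟨hq, hqc ▸ Dvd.intro ((depthIn V r u + c) / s + 1) rfl⟩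
        have hqp : r q p := hr.ancestor_of_depthIn_le hq hqv hpv (by omega)
        have huq : r u q := hr.ancestor_of_depthIn_le hu huv hqv (by omega)
        have l1 : Linked φ ((Δ₁ ∪ Δ₃) ∪ (Δ₂ ∪ Δ₄)) 1 u q :=
          .single (.inl (.inl ⟨u, hu, q, hqR, huq, by omega, by omega, rfl⟩))
        have l2 : Linked φ ((Δ₁ ∪ Δ₃) ∪ (Δ₂ ∪ Δ₄)) (2 * k + 1) q p :=
          (hlink₃ q hqR p hpR hqp).mono
            (Set.subset_union_right.trans Set.subset_union_left) le_rfl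
        have l3 : Linked φ ((Δ₁ ∪ Δ₃) ∪ (Δ₂ ∪ Δ₄)) 1 p v := by
          by_cases hpv' : p = v
          · exact hpv' ▸ .refl _ _
          · exact .single (.inr (.inl ⟨p, hp, v, hv, hpv, hr.depthIn_lt hv hpv hpv',
              by omega, hpc ▸ Dvd.intro _ rfl, rfl⟩))
        exact ((l1.append l2).append l3).mono subset_rfl (by omega)

end IsForestOrder

end Forest

/-! ### Translation of nested proofs. -/

/-- The conjunction of a context, nested to the left. -/
def contextFormula (Γ : List Formula) : Formula :=
  Γ.foldl Formula.and (Formula.var 0 ⇾ Formula.var 0)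

theorem contextFormula_concat (Γ : List Formula) (A : Formula) :
    contextFormula (Γ ++ [A]) = (contextFormula Γ).and A := by
  simp [contextFormula]

theorem isForestOrder_prefix : IsForestOrder fun Γ Δ : List Formula => Γ <+: Δ where
  refl _ := List.prefix_rfl
  antisymm h h' := h.eq_of_length (le_antisymm h.length_le h'.length_le)
  trans h h' := h.trans h'
  chain h h' := List.prefix_or_prefix_of_prefix h h'

namespace NestedSequence

variable {P : NestedSequence}

theorem numOpenings_le (P : NestedSequence) : P.numOpenings ≤ P.steps := by
  refine (Finset.card_filter_le _ _).trans ?_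
  simp

/-- Every nonempty initial part of a context has been opened. -/
theorem exists_opening {A : Formula} (h : P.IsProofOf A) {i : ℕ} (hi : i ≤ P.steps)
    {Δ : List Formula} (hΔ : Δ <+: P.ctx i) (hne : Δ ≠ []) :
    ∃ o, 1 ≤ o ∧ o ≤ P.steps ∧ (P.rule o).opens = true ∧ P.ctx o = Δ := by
  induction i using Nat.strong_induction_on with
  | _ i ih =>
    rcases Nat.eq_zero_or_pos i with rfl | hpos
    · rw [h.1] at hΔ
      exact absurd (List.prefix_nil.1 hΔ) hne
    · have hstep := h.2.2.1 i hpos hi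
      unfold StepOK at hstep
      split at hstep
      · exact ih (i - 1) (by omega) (by omega) (hstep.1 ▸ hΔ)
      · next k hrule =>
        rw [hstep.2, List.prefix_concat_iff] at hΔ
        rcases hΔ with rfl | hΔ
        · exact ⟨i, hpos, hi, by simp [hrule, NestedRule.opens], hstep.2⟩
        · have hk := hstep.1.1
          exact ih k hk (by omega) hΔ
      · next l k j hrule =>
        obtain ⟨-, -, hk, -, -, -, B, C, -, hctx, -⟩ := hstep
        exact ih k hk (by omega) (hΔ.trans (hctx ▸ List.prefix_append _ _))
      · exact ih (i - 1) (by omega) (by omega) (hstep.1 ▸ hΔ)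

open Classical in
/-- The contexts that occur in a proof. -/
noncomputable def contexts (P : NestedSequence) : Finset (List Formula) :=
  insert [] (((Finset.Icc 1 P.steps).filter fun i => (P.rule i).opens = true).image P.ctx)

theorem card_contexts_le (P : NestedSequence) : P.contexts.card ≤ P.numOpenings + 1 := by
  classical
  exact (Finset.card_insert_le _ _).trans (Nat.add_le_add_right Finset.card_image_le 1)

theorem mem_contexts {A : Formula} (h : P.IsProofOf A) {i : ℕ} (hi : i ≤ P.steps) :
    P.ctx i ∈ P.contexts := by
  classical
  by_cases hne : P.ctx i = []
  · rw [hne]; exact Finset.mem_insert_self _ _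
  · obtain ⟨o, h1, h2, h3, h4⟩ := exists_opening h hi List.prefix_rfl hne
    refine Finset.mem_insert_of_mem (Finset.mem_image.2 ⟨o, ?_, h4⟩)
    simp [h1, h2, h3]

/-- The context on which `Δ` was opened also occurs in the proof, so nothing shorter can be the
parent. Hence the edge to the parent is an instance of `a5`. -/
theorem parent_contexts {A : Formula} (h : P.IsProofOf A) {Γ Δ : List Formula}
    (hp : IsParentIn P.contexts (fun Γ Δ => Γ <+: Δ) Γ Δ) : ∃ B, Δ = Γ ++ [B] := by
  classical
  obtain ⟨-, hΔ, hpre, hne, hbetween⟩ := hp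
  rcases Finset.mem_insert.1 hΔ with rfl | hΔ
  · exact absurd (List.prefix_nil.1 hpre) hne
  obtain ⟨o, ho, rfl⟩ := Finset.mem_image.1 hΔ
  simp only [Finset.mem_filter, Finset.mem_Icc] at ho
  obtain ⟨⟨ho1, ho2⟩, hopens⟩ := ho
  have hstep := h.2.2.1 o ho1 ho2
  unfold StepOK at hstep
  split at hstep
  case h_2 k hrule =>
    have hk : k ≤ P.steps := hstep.1.1.le.trans ho2
    rcases hbetween (P.ctx k) (mem_contexts h hk)
      ((List.prefix_concat_iff.1 (hstep.2 ▸ hpre)).resolve_left fun e => hne (by rw [e, hstep.2]))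
      (hstep.2 ▸ List.prefix_append _ _) with e | e
    · exact ⟨_, e ▸ hstep.2⟩
    · have := congrArg List.length hstep.2
      rw [e] at this
      simp at this
  all_goals next hrule => simp [hrule, NestedRule.opens] at hopens

/-- The translation of step `i`. -/
def stepFormula (P : NestedSequence) (i : ℕ) : Formula :=
  contextFormula (P.ctx i) ⇾ contextFormula (P.ctx i) ⇾ P.fml i

theorem yields_stepFormula {A : Formula} (h : P.IsProofOf A) {S : Set Formula} {e : ℕ}
    (hS : ∀ Γ ∈ P.contexts, ∀ Δ ∈ P.contexts, Γ <+: Δ → Yields S e {edge contextFormula Γ Δ})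
    {i : ℕ} (hi : 1 ≤ i) (hiP : i ≤ P.steps)
    (hprev : ∀ j, 1 ≤ j → j < i → P.stepFormula j ∈ S) :
    Yields S (6 * e + 4000) {P.stepFormula i} := by
  have hprev' : ∀ l, 1 ≤ l → P.Available l i →
      Yields S (2 * e + 18) {contextFormula (P.ctx i) ⇾ contextFormula (P.ctx i) ⇾ P.fml l} := by
    rintro l hl ⟨hli, hpre, -⟩
    exact (Yields.weaken (hS _ (mem_contexts h (hli.le.trans hiP)) _ (mem_contexts h hiP) hpre)
      (Yields.mem (hprev l hl hli))).mono (by omega)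
  have hpos : ∀ {l : ℕ} {B : Formula}, P.ctx l = P.ctx i ++ [B] → 1 ≤ l := by
    intro l B hl
    rcases Nat.eq_zero_or_pos l with rfl | hl'
    · rw [h.1] at hl; simp at hl
    · exact hl'
  have hstep := h.2.2.1 i hi hiP
  unfold StepOK at hstep
  split at hstep
  · exact ((Yields.ax hstep.2).under _).mono (by omega)
  · rw [stepFormula, hstep.2, contextFormula_concat]
    exact ((Yields.ax (.a6 _ _)).imp_const _).mono (by omega)
  · obtain ⟨hl, hav, hk, -, hj, -, B, C, hBC, hctxk, hfk, hctxj, hfj⟩ := hstep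
    have h1 := hprev' _ hl hav
    have h2 := hprev _ (hpos hctxk) hk
    have h3 := hprev _ (hpos hctxj) hj
    rw [stepFormula, hctxk, hfk, contextFormula_concat] at h2
    rw [stepFormula, hctxj, hfj, contextFormula_concat] at h3
    rw [hBC] at h1
    exact (Yields.or_elim_under h1 (Yields.mem h2) (Yields.mem h3)).mono (by omega)
  · obtain ⟨-, hj, havj, hk, havk, hf⟩ := hstep
    have h1 := hprev' _ hj havj
    rw [hf] at h1
    exact (h1.mp_under (hprev' _ hk havk)).mono (by omega)

theorem exists_hlukProof {A : Formula} (h : P.IsProofOf A) (k t : ℕ)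
    (hkt : P.numOpenings + 1 ≤ ackermann k t) :
    ∃ L : List Formula, IsHLukProof L A ∧ L.length ≤
      (6 * (k + 1) * t + 16) * (P.numOpenings + 1) + P.steps * (36 * k + 5000) + 32 := by
  classical
  have hcard := P.card_contexts_le
  -- `[].dropLast = []`, so the root contributes the loop `γ ⇾ γ`; this alone accounts for a cost
  -- above `1`.
  have hparents := Yields.family (S := ∅) P.contexts (fun _ => 0)
    (fun Γ => edge contextFormula Γ.dropLast Γ) 16 (by
      intro Γ _
      rcases List.eq_nil_or_concat Γ with rfl | ⟨Δ, B, rfl⟩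
      · exact (Yields.imp_self _).mono (by omega)
      · rw [List.concat_eq_append, List.dropLast_concat, edge, contextFormula_concat]
        exact (Yields.ax (.a5 _ _)).mono (by omega))
  set S : Set Formula :=
    {A | ∃ Γ ∈ P.contexts, edge contextFormula Γ.dropLast Γ = A}
  obtain ⟨Δ, hΔ, hlink⟩ := isForestOrder_prefix.exists_shortcuts (V := P.contexts)
    (φ := contextFormula) (S := S) k t (by
      intro Γ Δ hp
      obtain ⟨B, rfl⟩ := parent_contexts h hp
      exact ⟨Γ ++ [B], hp.2.1, by rw [List.dropLast_concat]⟩)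
    (fun Γ _ => (depthIn_le_card _ _ _).trans (hcard.trans hkt))
  have hsteps := Yields.family (S := Δ) (Finset.Icc 1 P.steps) id P.stepFormula
    (6 * (3 * (2 * k + 1) + 15) + 4000) (by
      intro i hi
      obtain ⟨hi1, hi2⟩ := Finset.mem_Icc.1 hi
      refine yields_stepFormula h (fun Γ hΓ Θ hΘ hpre => ?_) hi1 hi2 fun j hj hji => ?_
      · exact (hlink Γ hΓ Θ hΘ hpre).yields.mono_left Set.subset_union_left
      · exact .inr ⟨j, Finset.mem_Icc.2 ⟨hj, by omega⟩, hji, rfl⟩)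
  have hall := hparents.trans ((hΔ.mono_left Set.subset_union_right).trans
    (hsteps.mono_left Set.subset_union_right))
  have hlast : Yields ∅ _ {P.stepFormula P.steps} := hall.mono_right (by
    rw [Set.singleton_subset_iff]
    exact .inr (.inr ⟨P.steps, Finset.mem_Icc.2 ⟨h.2.1, le_rfl⟩, rfl⟩))
  rw [stepFormula, h.2.2.2.1, h.2.2.2.2] at hlast
  -- The empty context translates to `p₀ ⇾ p₀`, whose two copies are detached here.
  obtain ⟨L, hL, hlen⟩ := ((hlast.mp (Yields.imp_self _)).mp (Yields.imp_self _)).exists_proof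
  refine ⟨L, hL, hlen.trans ?_⟩
  rw [Nat.card_Icc]
  calc _ ≤ (P.numOpenings + 1) * 16 + (6 * (k + 1) * t * (P.numOpenings + 1)
        + (P.steps + 1 - 1) * (6 * (3 * (2 * k + 1) + 15) + 4000)) + 15 + 1 + 15 + 1 := by gcongr
    _ ≤ _ := by rw [Nat.add_sub_cancel]; nlinarith

end NestedSequence

/-! ### The inverse Ackermann function and iterated logarithms. -/

theorem le_ackermann_inverseAckermann (n : ℕ) :
    n ≤ ackermann (inverseAckermann n) (inverseAckermann n) := by
  exact Nat.sInf_mem (s := {i | n ≤ ackermann i i})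
    ⟨n + 1, (Nat.le_succ n).trans (ackermann_lt (n + 1) (by omega)).le⟩

theorem inverseAckermann_pos {n : ℕ} (hn : 1 ≤ n) : 1 ≤ inverseAckermann n := by
  by_contra! h
  have := le_ackermann_inverseAckermann n
  rw [Nat.lt_one_iff.1 h] at this
  simp [ackermann] at this
  omega

/-- A function that lowers all arguments above `2` by at least `1` reaches `1` after at most
`n - 1` iterations from any `x ≤ n`. -/
theorem exists_iterate_le_one {f : ℝ → ℝ} {D : Set ℝ} (hD : Set.MapsTo f D D)
    (hf : ∀ y ∈ D, 1 < y → f y ≤ max 1 (y - 1)) (n : ℕ) {x : ℝ} (hx : x ∈ D)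
    (hxn : x ≤ n + 1) : ∃ k ≤ n, f^[k] x ≤ 1 := by
  induction n generalizing x with
  | zero => exact ⟨0, le_rfl, by simpa using hxn⟩
  | succ n ih =>
    by_cases h : x ≤ 1
    · exact ⟨0, Nat.zero_le _, h⟩
    · obtain ⟨k, hk, hle⟩ := ih (hD hx) ((hf x hx (not_le.1 h)).trans
        (max_le (by linarith [(Nat.cast_nonneg n : (0 : ℝ) ≤ n)]) (by push_cast at hxn; linarith)))
      exact ⟨k + 1, by omega, hle⟩

theorem logb_two_le {y : ℝ} (hy : 1 < y) : Real.logb 2 y ≤ max 1 (y - 1) := by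
  rcases le_total y 2 with h | h
  · refine le_max_of_le_left ?_
    rw [Real.logb_le_iff_le_rpow (by norm_num) (by linarith)]
    simpa using h
  · refine le_max_of_le_right ?_
    rw [Real.logb_le_iff_le_rpow (by norm_num) (by linarith)]
    have := one_add_mul_self_le_rpow_one_add (s := 1) (by norm_num) (p := y - 1) (by linarith)
    norm_num at this
    linarith

/-- Since `sInf ∅ = 0`, a lower bound on `logStar (i + 1)` requires that some iterate does reach
`1`. From level `i + 1` on the values are natural numbers, so the induction can stay within
`Set.range Nat.cast`. -/
theorem exists_logStar_iterate_le_one (i n : ℕ) :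
    ∃ k ≤ n, (logStar i)^[k] ((n : ℝ) + 1) ≤ 1 := by
  induction i generalizing n with
  | zero =>
    exact exists_iterate_le_one (D := Set.univ) (Set.mapsTo_univ _ _)
      (fun y _ hy => by rw [logStar]; exact logb_two_le hy) n trivial le_rfl
  | succ i ih =>
    refine exists_iterate_le_one (D := Set.range Nat.cast) (fun y _ => ?_) ?_ n
      ⟨n + 1, by push_cast; rfl⟩ le_rfl
    · rw [logStar]
      exact Set.mem_range_self _
    · rintro _ ⟨m, rfl⟩ hm
      obtain ⟨m, rfl⟩ : ∃ m', m = m' + 1 := ⟨m - 1, by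
        have : 1 < m := by exact_mod_cast hm
        omega⟩
      obtain ⟨k, hk, hle⟩ := ih m
      refine le_max_of_le_right ?_
      rw [logStar]
      have h1 : sInf {k : ℕ | (logStar i)^[k] ((m + 1 : ℕ) : ℝ) ≤ 1} ≤ m :=
        (Nat.sInf_le (by simpa using hle)).trans hk
      have h2 : ((sInf {k : ℕ | (logStar i)^[k] ((m + 1 : ℕ) : ℝ) ≤ 1} : ℕ) : ℝ) ≤ m := by
        exact_mod_cast h1
      push_cast at h2 ⊢
      linarith

theorem one_le_logStar (i : ℕ) {m : ℕ} (hm : 2 ≤ m) : 1 ≤ logStar i m := by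
  have hm' : (2 : ℝ) ≤ m := by exact_mod_cast hm
  cases i with
  | zero =>
    rw [logStar, Real.le_logb_iff_rpow_le (by norm_num) (by linarith)]
    simpa using hm'
  | succ i =>
    obtain ⟨k, -, hk⟩ := exists_logStar_iterate_le_one i (m - 1)
    rw [Nat.cast_sub (by omega), Nat.cast_one, sub_add_cancel] at hk
    have hmem := Nat.sInf_mem (s := {k : ℕ | (logStar i)^[k] (m : ℝ) ≤ 1}) ⟨k, hk⟩
    rw [logStar, Nat.one_le_cast, Nat.one_le_iff_ne_zero]
    intro h0
    rw [h0] at hmem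
    simp only [Set.mem_ofPred_eq, Function.iterate_zero, id_eq] at hmem
    linarith

theorem mainTheorem2 :
    (∃ C : ℕ, ∀ (A : Formula) (P : NestedSequence), P.IsProofOf A →
      ∃ L : List Formula, IsHLukProof L A ∧
        L.length ≤ C * (P.steps * inverseAckermann P.steps)) ∧
    (∃ C : ℝ, ∀ (i : ℕ) (A : Formula) (P : NestedSequence), P.IsProofOf A →
      ∃ L : List Formula, IsHLukProof L A ∧
        (L.length : ℝ) ≤
          C * (P.steps * max 1 (P.numOpenings * logStar i P.numOpenings))) := by
  refine ⟨⟨6000, fun A P h => ?_⟩, ⟨6000, fun i A P h => ?_⟩⟩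
  · have hn : 1 ≤ P.steps := h.2.1
    have hα := inverseAckermann_pos hn
    have hA := le_ackermann_inverseAckermann P.steps
    have hA' := ackermann_diag_lt (inverseAckermann P.steps)
    have hm := P.numOpenings_le
    set α := inverseAckermann P.steps
    -- `m ≤ n ≤ ackermann α α < ackermann (α + 1) 4`, with `m` openings and `n` steps.
    obtain ⟨L, hL, hlen⟩ := NestedSequence.exists_hlukProof h (α + 1) 4 (by omega)
    refine ⟨L, hL, hlen.trans ?_⟩
    have h1 : P.numOpenings + 1 ≤ 2 * P.steps := by omega
    have h2 : P.steps ≤ P.steps * α := Nat.le_mul_of_pos_right _ hα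
    calc _ ≤ (6 * (α + 1 + 1) * 4 + 16) * (2 * P.steps)
          + P.steps * (36 * (α + 1) + 5000) + 32 := by gcongr
      _ = 84 * (P.steps * α) + 5164 * P.steps + 32 := by ring
      _ ≤ _ := by omega
  · have hn : 1 ≤ P.steps := h.2.1
    have hm := P.numOpenings_le
    -- For `k = 0` every ancestor gets a direct edge. The quadratic cost is absorbed by `m + 1 ≤ 2 *
    -- n`.
    obtain ⟨L, hL, hlen⟩ := NestedSequence.exists_hlukProof h 0 (P.numOpenings + 1)
      (by rw [ackermann]; omega)
    refine ⟨L, hL, ?_⟩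
    have h1 : P.numOpenings + 1 ≤ 2 * P.steps := by omega
    have h2 : L.length ≤ P.steps * (12 * P.numOpenings + 5076) := by
      refine hlen.trans ?_
      calc _ ≤ (6 * (0 + 1) * (P.numOpenings + 1) + 16) * (2 * P.steps)
            + P.steps * (36 * 0 + 5000) + 32 * P.steps := by gcongr; omega
        _ = _ := by ring
    have h3 : (L.length : ℝ) ≤ P.steps * (12 * P.numOpenings + 5076) := by exact_mod_cast h2
    have h4 : (P.numOpenings : ℝ) ≤ max 1 (P.numOpenings * logStar i P.numOpenings) := by
      rcases Nat.lt_or_ge P.numOpenings 2 with hlt | hge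
      · refine le_max_of_le_left ?_
        exact_mod_cast Nat.le_of_lt_succ hlt
      · exact le_max_of_le_right
          (le_mul_of_one_le_right (Nat.cast_nonneg _) (one_le_logStar i hge))
    have h5 := le_max_left (1 : ℝ) (P.numOpenings * logStar i P.numOpenings)
    calc (L.length : ℝ) ≤ P.steps * (12 * P.numOpenings + 5076) := h3
      _ ≤ P.steps * (6000 * max 1 (P.numOpenings * logStar i P.numOpenings)) := by
        refine mul_le_mul_of_nonneg_left ?_ (Nat.cast_nonneg _)
        linarith
      _ = _ := by ring
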